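/- Let $\mathcal H$ be a complex Hilbert space (inner product antilinear in the first argument), let $A$ and $B$ be self-adjoint, possibly unbounded operators on $\mathcal H$ with spectral measures $E_A$, $E_B$ on $\mathbb R$, let $0\neq\phi\in\mathcal H$ and $\alpha\in\mathbb C$. For $z=z_1+iz_2$ and $w=w_1+iw_2$ in $\mathbb C$ put $\langle z,w\rangle:=z_1w_1+z_2w_2$, and for $s\in\mathbb C$, $t\in\mathbb R$ define $$\#^{\alpha}_{\mathrm{cnv}}(s,t):=e^{-i\langle s,(1-\alpha)/2\rangle A}\,e^{-itB}\,e^{-i\langle s,(1+\alpha)/2\rangle A},$$ where $e^{-ixA}=\int_{\mathbb R}e^{-ixa}\,dE_A(a)$ and $e^{-itB}=\int_{\mathbb R}e^{-itb}\,dE_B(b)$. Suppose that $\mu$ is a complex Borel measure on $\mathbb C\times\mathbb R$ whose Fourier transform satisfies $$\int_{\mathbb C\times\mathbb R}e^{-i(\langle s,a\rangle+tb)}\,d\mu(a,b)=\frac{\langle\phi,\#^{\alpha}_{\mathrm{cnv}}(s,t)\,\phi\rangle}{\|\phi\|^{2}}\qquad\text{for all } s\in\mathbb C,\ t\in\mathbb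 R.$$ Then $\mu$ is a quasi-joint-probability distribution of $A$ and $B$ on $\phi$; that is, $\mu(\mathbb C\times\mathbb R)=1$ and $$\mu(\Delta\times\mathbb R)=\mu_A^\phi(\Delta)\quad(\Delta\subseteq\mathbb C\text{ Borel}),\qquad \mu(\mathbb C\times\Delta)=\mu_B^\phi(\Delta)\quad(\Delta\subseteq\mathbb R\text{ Borel}).$$ Here $\mu_B^\phi(\Delta)=\langle\phi,E_B(\Delta)\phi\rangle/\|\phi\|^2$ and $\mu_A^\phi(\Delta)=\langle\phi,\tilde E_A(\Delta)\phi\rangle/\|\phi\|^2$, where $\tilde E_A(\Delta)=E_A(\Delta\cap\mathbb R)$ is the spectral measure on $\mathbb C$ of $A$ regarded as a normal operator. -/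

import Mathlib

open MeasureTheory

noncomputable section

namespace QuasiJoint

/-- The integral `∫ f dν` of a complex function with respect to a complex measure. -/
def cintegral {X : Type*} [MeasurableSpace X] (ν : ComplexMeasure X) (f : X → ℂ) : ℂ :=
  VectorMeasure.integral ν f (ContinuousLinearMap.mul ℝ ℂ)

theorem cintegral_smul {X : Type*} [MeasurableSpace X] {ν : ComplexMeasure X} {f : X → ℂ}
    (hf : ν.Integrable f) (c : ℂ) : cintegral (c • ν) f = c * cintegral ν f := by
  let L : ℂ →L[ℝ] ℂ := ContinuousLinearMap.mul ℝ ℂ c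
  have h := VectorMeasure.continuousLinearMap_apply_integral (μ := ν) (f := f)
    (B := ContinuousLinearMap.mul ℝ ℂ) (C := L) hf
  change _ = L _
  unfold cintegral
  rw [h]
  set B' := (ContinuousLinearMap.compL ℝ ℂ ℂ ℂ L) ∘L (ContinuousLinearMap.mul ℝ ℂ) with hB'
  have ht : (c • ν).transpose (ContinuousLinearMap.mul ℝ ℂ) = ν.transpose B' := by
    refine VectorMeasure.ext fun s _ => ContinuousLinearMap.ext fun x => ?_
    change x * (c * ν s) = c * (x * ν s)
    ring
  have hd : DominatedFinMeasAdditive ν.variation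
      ((c • ν).transpose (ContinuousLinearMap.mul ℝ ℂ)) ‖B'‖ := by
    rw [ht]; exact dominatedFinMeasAdditive_cbmApplyMeasure ν B'
  have h1 := setToFun_congr_measure_of_integrable (‖c‖₊ : ENNReal) ENNReal.coe_ne_top
    (μ' := (c • ν).variation) (by rw [VectorMeasure.variation_smul]; exact le_rfl) hd
    (dominatedFinMeasAdditive_cbmApplyMeasure (c • ν) (ContinuousLinearMap.mul ℝ ℂ)) f hf
  rw [VectorMeasure.integral_eq_setToFun, VectorMeasure.integral_eq_setToFun, ← h1]
  congr 1
  rw [ht]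

/-- A spectral measure (projection-valued measure) on the measurable space `X`, with values in the
bounded operators of the Hilbert space `H`. Sets that are not measurable get the value `0`, as in
Mathlib's `VectorMeasure`. -/
structure SpectralMeasure (X : Type*) [MeasurableSpace X] (H : Type*) [NormedAddCommGroup H]
    [InnerProductSpace ℂ H] [CompleteSpace H] where
  /-- the operator `E(Δ)` -/
  proj : Set X → H →L[ℂ] H
  isStarProjection : ∀ Δ, MeasurableSet Δ → IsStarProjection (proj Δ)
  not_measurable : ∀ Δ, ¬ MeasurableSet Δ → proj Δ = 0
  empty : proj ∅ = 0
  univ : proj Set.univ = 1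
  hasSum_iUnion : ∀ Δ : ℕ → Set X, (∀ i, MeasurableSet (Δ i)) →
    Pairwise (Function.onFun Disjoint Δ) →
    ∀ φ : H, HasSum (fun i => proj (Δ i) φ) (proj (⋃ i, Δ i) φ)

namespace SpectralMeasure

variable {X : Type*} [MeasurableSpace X] {Y : Type*} [MeasurableSpace Y] {H : Type*}
  [NormedAddCommGroup H] [InnerProductSpace ℂ H] [CompleteSpace H]

/-- The complex measure `Δ ↦ ⟨ψ, E(Δ) φ⟩`. -/
def pairing (E : SpectralMeasure X H) (ψ φ : H) : ComplexMeasure X where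
  measureOf' Δ := inner ℂ ψ (E.proj Δ φ)
  empty' := by simp [E.empty]
  not_measurable' Δ hΔ := by simp [E.not_measurable Δ hΔ]
  m_iUnion' Δ hΔ hd := (E.hasSum_iUnion Δ hΔ hd φ).mapL (innerSL ℂ ψ)

/-- The distribution `Δ ↦ ⟨φ, E(Δ) φ⟩ / ‖φ‖²` of the outcomes on the state `φ`. -/
def distribution (E : SpectralMeasure X H) (φ : H) : ComplexMeasure X :=
  ((‖φ‖ ^ 2 : ℝ) : ℂ)⁻¹ • E.pairing φ φ

/-- The unbounded operator `N` is the spectral integral `∫ f dE`: its domain consists of the `φ`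
with `∫ |f|² d⟨φ, Eφ⟩ < ∞`, and `⟨ψ, Nφ⟩ = ∫ f d⟨ψ, Eφ⟩` there. -/
structure Represents (E : SpectralMeasure X H) (f : X → ℂ) (N : H →ₗ.[ℂ] H) : Prop where
  mem_domain_iff : ∀ φ : H, φ ∈ N.domain ↔
    (E.pairing φ φ).Integrable (fun x => ‖f x‖ ^ 2)
  inner_apply : ∀ (ψ : H) (φ : N.domain),
    inner ℂ ψ (N φ) = cintegral (E.pairing ψ φ) f

/-- The push-forward (image) of a spectral measure under a measurable map. -/
def map (E : SpectralMeasure X H) (g : X → Y) (hg : Measurable g) : SpectralMeasure Y H where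
  proj Δ := open Classical in if MeasurableSet Δ then E.proj (g ⁻¹' Δ) else 0
  isStarProjection Δ hΔ := by
    rw [if_pos hΔ]; exact E.isStarProjection _ (hg hΔ)
  not_measurable Δ hΔ := if_neg hΔ
  empty := by simp [E.empty]
  univ := by simp [E.univ]
  hasSum_iUnion Δ hΔ hd φ := by
    simp only [if_pos (MeasurableSet.iUnion hΔ), if_pos (hΔ _), Set.preimage_iUnion]
    exact E.hasSum_iUnion (fun i => g ⁻¹' Δ i) (fun i => hg (hΔ i))
      (fun i j hij => (hd hij).preimage g) φ

/-- The spectral measure concentrated at one point. -/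
def dirac (x : X) : SpectralMeasure X H where
  proj Δ := open Classical in if MeasurableSet Δ ∧ x ∈ Δ then 1 else 0
  isStarProjection Δ _ := by
    split_ifs
    · exact IsStarProjection.one _
    · exact IsStarProjection.zero _
  not_measurable Δ hΔ := by simp [hΔ]
  empty := by simp
  univ := by simp
  hasSum_iUnion Δ hΔ hd φ := by
    by_cases hx : ∃ i, x ∈ Δ i
    · obtain ⟨i, hi⟩ := hx
      have h1 : MeasurableSet (⋃ i, Δ i) ∧ x ∈ ⋃ i, Δ i :=
        ⟨MeasurableSet.iUnion hΔ, Set.mem_iUnion.2 ⟨i, hi⟩⟩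
      rw [if_pos h1]
      convert hasSum_single i (f := fun j => (open Classical in
        if MeasurableSet (Δ j) ∧ x ∈ Δ j then (1 : H →L[ℂ] H) else 0) φ) ?_ using 1
      · simp [hΔ i, hi]
      · intro j hj
        have : x ∉ Δ j := fun h => Set.disjoint_left.1 (hd hj) h hi
        simp [this]
    · push Not at hx
      simp [hx, hasSum_zero]

instance [Nonempty X] : Nonempty (SpectralMeasure X H) :=
  ⟨dirac (Classical.arbitrary X)⟩

theorem inner_proj (E : SpectralMeasure X H) {Δ : Set X} (hΔ : MeasurableSet Δ) (ψ φ : H) :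
    inner ℂ ψ (E.proj Δ φ) = inner ℂ (E.proj Δ ψ) (E.proj Δ φ) := by
  have h := E.isStarProjection Δ hΔ
  have h1 : (E.proj Δ).adjoint = E.proj Δ := h.isSelfAdjoint
  have h2 : E.proj Δ (E.proj Δ φ) = E.proj Δ φ := by
    have := h.isIdempotentElem
    exact congrArg (fun T : H →L[ℂ] H => T φ) this
  rw [← ContinuousLinearMap.adjoint_inner_right, h1, h2]

theorem norm_proj_le (E : SpectralMeasure X H) {Δ : Set X} (hΔ : MeasurableSet Δ) (φ : H) :
    ‖E.proj Δ φ‖ ≤ ‖φ‖ := by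
  have h := E.inner_proj hΔ φ φ
  have h1 : ‖E.proj Δ φ‖ ^ 2 ≤ ‖φ‖ * ‖E.proj Δ φ‖ := by
    have h2 := norm_inner_le_norm (𝕜 := ℂ) φ (E.proj Δ φ)
    rw [h, inner_self_eq_norm_sq_to_K] at h2
    simpa using h2
  by_contra hc
  push Not at hc
  nlinarith [norm_nonneg φ, norm_nonneg (E.proj Δ φ)]

theorem sum_norm_proj_sq_le (E : SpectralMeasure X H) (P : Finset (Set X))
    (hP : (P : Set (Set X)).PairwiseDisjoint id) (hm : ∀ t ∈ P, MeasurableSet t) (φ : H) :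
    ∑ p ∈ P, ‖E.proj p φ‖ ^ 2 ≤ ‖φ‖ ^ 2 := by
  have hU : MeasurableSet (⋃ p ∈ P, p) := P.measurableSet_biUnion hm
  have h := VectorMeasure.of_biUnion_finset (v := E.pairing φ φ) (f := id) hP hm
  have key : ∀ {Δ : Set X}, MeasurableSet Δ →
      E.pairing φ φ Δ = ((‖E.proj Δ φ‖ ^ 2 : ℝ) : ℂ) := fun {Δ} hΔ => by
    change inner ℂ φ (E.proj Δ φ) = _
    rw [E.inner_proj hΔ, inner_self_eq_norm_sq_to_K]; simp
  have h' : ((‖E.proj (⋃ p ∈ P, p) φ‖ ^ 2 : ℝ) : ℂ) = ((∑ p ∈ P, ‖E.proj p φ‖ ^ 2 : ℝ) : ℂ) := by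
    rw [← key hU, Complex.ofReal_sum, ← Finset.sum_congr rfl fun p hp => key (hm p hp)]
    exact h
  rw [← Complex.ofReal_injective h']
  gcongr
  exact E.norm_proj_le hU φ

theorem variation_pairing_le (E : SpectralMeasure X H) (ψ φ : H) :
    (E.pairing ψ φ).variation Set.univ ≤ ENNReal.ofReal (‖ψ‖ * ‖φ‖) := by
  by_contra hc
  push Not at hc
  obtain ⟨P, -, hd, hm, hP⟩ :=
    VectorMeasure.exists_lt_sum_of_lt_variation _ MeasurableSet.univ hc
  refine absurd hP (not_lt.2 ?_)
  have h1 : ∀ p ∈ P, ‖E.pairing ψ φ p‖ ≤ ‖E.proj p ψ‖ * ‖E.proj p φ‖ := fun p hp => by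
    change ‖inner ℂ ψ (E.proj p φ)‖ ≤ _
    rw [E.inner_proj (hm p hp)]
    exact norm_inner_le_norm _ _
  have h2 : ∑ p ∈ P, ‖E.pairing ψ φ p‖ₑ = ENNReal.ofReal (∑ p ∈ P, ‖E.pairing ψ φ p‖) := by
    rw [ENNReal.ofReal_sum_of_nonneg fun _ _ => norm_nonneg _]
    exact Finset.sum_congr rfl fun p _ => (ofReal_norm _).symm
  rw [h2]
  refine ENNReal.ofReal_le_ofReal ((Finset.sum_le_sum h1).trans ?_)
  have h3 := Finset.sum_mul_sq_le_sq_mul_sq P (fun p => ‖E.proj p ψ‖) (fun p => ‖E.proj p φ‖)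
  refine abs_le_of_sq_le_sq' ?_ (by positivity) |>.2
  rw [mul_pow]
  exact h3.trans (mul_le_mul (E.sum_norm_proj_sq_le P hd hm ψ) (E.sum_norm_proj_sq_le P hd hm φ)
    (Finset.sum_nonneg fun _ _ => sq_nonneg _) (sq_nonneg _))

instance (E : SpectralMeasure X H) (ψ φ : H) : IsFiniteMeasure (E.pairing ψ φ).variation :=
  ⟨(E.variation_pairing_le ψ φ).trans_lt ENNReal.ofReal_lt_top⟩

theorem norm_cintegral_pairing_le (E : SpectralMeasure X H) {f : X → ℂ} {C : ℝ} (hC : 0 ≤ C)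
    (hf : ∀ x, ‖f x‖ ≤ C) (ψ φ : H) :
    ‖cintegral (E.pairing ψ φ) f‖ ≤ C * ‖ψ‖ * ‖φ‖ := by
  have h := VectorMeasure.norm_integral_le_of_norm_le_const (μ := E.pairing ψ φ)
    (B := ContinuousLinearMap.mul ℝ ℂ) (f := f) (C := C) (Filter.Eventually.of_forall hf)
  have h1 : (E.pairing ψ φ).variation.real Set.univ ≤ ‖ψ‖ * ‖φ‖ :=
    ENNReal.toReal_le_of_le_ofReal (by positivity) (E.variation_pairing_le ψ φ)
  have h2 : ‖ContinuousLinearMap.mul ℝ ℂ‖ ≤ 1 := ContinuousLinearMap.opNorm_mul_le ℝ ℂ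
  calc _ ≤ C * ‖ContinuousLinearMap.mul ℝ ℂ‖ * (E.pairing ψ φ).variation.real Set.univ := h
    _ ≤ C * 1 * (‖ψ‖ * ‖φ‖) := by gcongr
    _ = _ := by ring

/-- The operator `∫ f dE` exists for every bounded measurable `f`. -/
theorem exists_boundedIntegral (E : SpectralMeasure X H) {f : X → ℂ} (hf : Measurable f)
    {C : ℝ} (hC : ∀ x, ‖f x‖ ≤ C) :
    ∃ T : H →L[ℂ] H, ∀ ψ φ : H, inner ℂ ψ (T φ) = cintegral (E.pairing ψ φ) f := by
  have hint : ∀ ψ φ, (E.pairing ψ φ).Integrable f := fun ψ φ =>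
    MeasureTheory.Integrable.of_bound hf.aestronglyMeasurable C (Filter.Eventually.of_forall hC)
  have addl : ∀ ψ ψ' φ, E.pairing (ψ + ψ') φ = E.pairing ψ φ + E.pairing ψ' φ :=
    fun ψ ψ' φ => VectorMeasure.ext fun Δ _ => inner_add_left _ _ _
  have addr : ∀ ψ φ φ', E.pairing ψ (φ + φ') = E.pairing ψ φ + E.pairing ψ φ' :=
    fun ψ φ φ' => VectorMeasure.ext fun Δ _ => by
      change inner ℂ ψ (E.proj Δ (φ + φ')) = _
      rw [_root_.map_add, inner_add_right]; rfl
  have smull : ∀ (c : ℂ) ψ φ, E.pairing (c • ψ) φ = (starRingEnd ℂ c) • E.pairing ψ φ :=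
    fun c ψ φ => VectorMeasure.ext fun Δ _ => inner_smul_left _ _ _
  have smulr : ∀ (c : ℂ) ψ φ, E.pairing ψ (c • φ) = c • E.pairing ψ φ :=
    fun c ψ φ => VectorMeasure.ext fun Δ _ => by
      change inner ℂ ψ (E.proj Δ (c • φ)) = _
      rw [_root_.map_smul, inner_smul_right]; rfl
  obtain hX | ⟨⟨x⟩⟩ := isEmpty_or_nonempty X |>.imp_right fun h => (⟨h⟩ : Nonempty (Nonempty X))
  · refine ⟨0, fun ψ φ => ?_⟩
    simp [cintegral, VectorMeasure.integral_of_isEmpty]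
  obtain ⟨x⟩ := x
  have hC0 : 0 ≤ C := (norm_nonneg _).trans (hC x)
  let S : H →L⋆[ℂ] H →L[ℂ] ℂ := LinearMap.mkContinuous₂
    (LinearMap.mk₂'ₛₗ (starRingEnd ℂ) (RingHom.id ℂ)
      (fun ψ φ => cintegral (E.pairing ψ φ) f)
      (fun ψ ψ' φ => by
        rw [addl]; exact VectorMeasure.integral_add_vectorMeasure (hint _ _) (hint _ _))
      (fun c ψ φ => by rw [smull, cintegral_smul (hint _ _)]; rfl)
      (fun ψ φ φ' => by
        rw [addr]; exact VectorMeasure.integral_add_vectorMeasure (hint _ _) (hint _ _))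
      (fun c ψ φ => by rw [smulr, cintegral_smul (hint _ _)]; rfl)) C
    (fun ψ φ => E.norm_cintegral_pairing_le hC0 hC ψ φ)
  refine ⟨(InnerProductSpace.continuousLinearMapOfBilin S).adjoint, fun ψ φ => ?_⟩
  rw [ContinuousLinearMap.adjoint_inner_right, InnerProductSpace.continuousLinearMapOfBilin_apply]
  rfl

/-- The bounded operator `∫ f dE` for a bounded measurable function `f`, characterised by
`⟨ψ, (∫ f dE) φ⟩ = ∫ f d⟨ψ, Eφ⟩`; it exists by `exists_boundedIntegral`. -/
def boundedIntegral (E : SpectralMeasure X H) (f : X → ℂ) : H →L[ℂ] H :=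
  Classical.epsilon fun T : H →L[ℂ] H =>
    ∀ ψ φ : H, inner ℂ ψ (T φ) = cintegral (E.pairing ψ φ) f

/-- If `N = ∫ (f ∘ g) dE`, then `N = ∫ f d(g(E))` for the image spectral measure `g(E)`. -/
theorem Represents.map {E : SpectralMeasure X H} {g : X → Y} (hg : MeasurableEmbedding g)
    {f : Y → ℂ} {N : H →ₗ.[ℂ] H} (h : E.Represents (fun x => f (g x)) N) :
    (E.map g hg.measurable).Represents f N := by
  have hp : ∀ ψ φ, (E.map g hg.measurable).pairing ψ φ = (E.pairing ψ φ).map g := fun ψ φ =>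
    VectorMeasure.ext fun Δ hΔ => by
      rw [VectorMeasure.map_apply _ hg.measurable hΔ]
      change inner ℂ ψ ((E.map g hg.measurable).proj Δ φ) = inner ℂ ψ (E.proj (g ⁻¹' Δ) φ)
      simp only [SpectralMeasure.map, if_pos hΔ]
  refine ⟨fun φ => ?_, fun ψ φ => ?_⟩
  · rw [h.mem_domain_iff, hp, hg.integrable_map_vectorMeasure]
    rfl
  · rw [h.inner_apply, hp]
    exact hg.integral_map_vectorMeasure.symm

end SpectralMeasure

variable {H : Type*} [NormedAddCommGroup H] [InnerProductSpace ℂ H] [CompleteSpace H]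

/-- The spectral measure `E_A` on `ℝ` of a self-adjoint operator `A`: the unique one with
`A = ∫ a dE_A(a)`. -/
def spectralMeasure (A : H →ₗ.[ℂ] H) : SpectralMeasure ℝ H :=
  Classical.epsilon fun E => E.Represents (fun a : ℝ => (a : ℂ)) A

/-- The two-dimensional spectral measure of a self-adjoint operator `A`, regarded as a normal
operator: the image of `E_A` under the inclusion `ℝ ⊆ ℂ`, i.e. `Δ ↦ E_A(Δ ∩ ℝ)`. -/
def normalSpectralMeasure (A : H →ₗ.[ℂ] H) : SpectralMeasure ℂ H :=
  (spectralMeasure A).map Complex.ofReal Complex.measurable_ofReal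

/-- `normalSpectralMeasure A` is a spectral measure of `A` in the sense of the spectral theorem for
normal operators, `A = ∫ z dE(z)` over `ℂ`. -/
theorem normalSpectralMeasure_represents {A : H →ₗ.[ℂ] H}
    (h : ∃ E : SpectralMeasure ℝ H, E.Represents (fun a : ℝ => (a : ℂ)) A) :
    (normalSpectralMeasure A).Represents (fun z : ℂ => z) A :=
  SpectralMeasure.Represents.map (f := fun z : ℂ => z)
    Complex.isometry_ofReal.isClosedEmbedding.measurableEmbedding (Classical.epsilon_spec h)

/-- The unitary operator `e^{-itA} = ∫ e^{-ita} dE_A(a)`. -/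
def expOp (A : H →ₗ.[ℂ] H) (t : ℝ) : H →L[ℂ] H :=
  (spectralMeasure A).boundedIntegral fun a => Complex.exp (-(Complex.I * t * a))

/-- The inner product of two complex numbers understood as vectors of `ℝ²`. -/
def dot (s α : ℂ) : ℝ := s.re * α.re + s.im * α.im

/-- The hashed operator `e^{-i⟨s,(1-α)/2⟩A} e^{-itB} e^{-i⟨s,(1+α)/2⟩A}`. -/
def hashCnv (A B : H →ₗ.[ℂ] H) (α s : ℂ) (t : ℝ) : H →L[ℂ] H :=
  expOp A (dot s ((1 - α) / 2)) * expOp B t * expOp A (dot s ((1 + α) / 2))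

/-- The Fourier transform `(s, t) ↦ ∫ e^{-i(⟨s,a⟩ + tb)} dμ(a,b)` of a complex measure on
`ℂ × ℝ`. -/
def fourier (μ : ComplexMeasure (ℂ × ℝ)) (s : ℂ) (t : ℝ) : ℂ :=
  cintegral μ fun p => Complex.exp (-(Complex.I * ((dot s p.1 + t * p.2 : ℝ) : ℂ)))

/-- The complex measure `μ` is a quasi-probability measure on `ℂ × ℝ` that qualifies as a
quasi-joint-probability distribution of `A` and `B` on the state `φ`. -/
structure IsQJPDistribution (A B : H →ₗ.[ℂ] H) (φ : H) (μ : ComplexMeasure (ℂ × ℝ)) : Prop where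
  total : μ Set.univ = 1
  marginal_fst : ∀ Δ : Set ℂ, MeasurableSet Δ →
    μ (Δ ×ˢ Set.univ) = (normalSpectralMeasure A).distribution φ Δ
  marginal_snd : ∀ Δ : Set ℝ, MeasurableSet Δ →
    μ (Set.univ ×ˢ Δ) = (spectralMeasure B).distribution φ Δ

end QuasiJoint
end

/-! Each marginal is a complex measure whose Fourier transform is that of `μ` restricted to an axis.
At `t = 0` the middle factor of the hashed operator is the identity and the outer two merge by the
group law; since `(1-α)/2 + (1+α)/2 = 1`, what remains is `e^{-i(Re s)A}`, whatever `α` is. At `s =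
0` only `e^{-itB}` survives. Their normalised expectations on `φ` are the Fourier transforms of the
two spectral distributions, so uniqueness of the Fourier transform identifies the marginals.

Two ingredients carry the argument. `complexMeasure_ext_of_fourier` reduces uniqueness for complex
measures to characteristic functions of finite positive measures, through Jordan decompositions.
`boundedIntegral_mul` gives the group law of `expOp`; it rests on `E(Δ)E(Δ') = E(Δ ∩ Δ')`, which is
derived, not assumed. Identities between integrals are checked on indicators and extended by `L¹`
density. -/

namespace QuasiJoint

/-! ### Integration against complex measures -/

section ComplexMeasure

variable {X : Type*} [MeasurableSpace X]

/-- The variation is dominated by the sum of the total variations of the real and imaginary parts.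
Finiteness makes bounded measurable functions integrable. -/
instance isFiniteMeasure_variation (ν : ComplexMeasure X) : IsFiniteMeasure ν.variation := by
  refine isFiniteMeasure_of_le
    ((ComplexMeasure.re ν).totalVariation + (ComplexMeasure.im ν).totalVariation)
    (VectorMeasure.variation_le_of_forall_enorm_le fun s _ => ?_)
  have h1 := SignedMeasure.enorm_le_totalVariation (ComplexMeasure.re ν) s
  have h2 := SignedMeasure.enorm_le_totalVariation (ComplexMeasure.im ν) s
  calc ‖ν s‖ₑ = ‖((ν s).re : ℂ) + (ν s).im * Complex.I‖ₑ := by rw [Complex.re_add_im]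
    _ ≤ ‖((ν s).re : ℂ)‖ₑ + ‖((ν s).im : ℂ) * Complex.I‖ₑ := enorm_add_le _ _
    _ = ‖(ν s).re‖ₑ + ‖(ν s).im‖ₑ := by simp [← ofReal_norm]
    _ ≤ _ := add_le_add h1 h2

/-- An additive functional of integrable functions which is continuous for the `L¹` norm and
vanishes on the multiples of indicators vanishes. -/
theorem eq_zero_of_indicator_eq_zero {m : Measure X} [IsFiniteMeasure m]
    (D : (X → ℂ) → ℂ) (C : ℝ)
    (hadd : ∀ f g, Integrable f m → Integrable g m → D (f + g) = D f + D g)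
    (hbound : ∀ f, Integrable f m → ‖D f‖ ≤ C * ∫ x, ‖f x‖ ∂m)
    (hind : ∀ (c : ℂ) (s : Set X), MeasurableSet s → D (s.indicator fun _ => c) = 0)
    {f : X → ℂ} (hf : Integrable f m) : D f = 0 := by
  have hsub : ∀ f g, Integrable f m → Integrable g m →
      ‖D f - D g‖ ≤ C * ∫ x, ‖f x - g x‖ ∂m := fun f g hf hg => by
    have h := hadd (f - g) g (hf.sub hg) hg
    rw [sub_add_cancel] at h
    rw [h, add_sub_cancel_right]
    exact hbound _ (hf.sub hg)
  refine Integrable.induction (P := fun f => D f = 0) (μ := m) (fun c s hs _ => hind c s hs)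
    (fun f g _ hf hg h1 h2 => by simp [hadd f g hf hg, h1, h2]) ?_ (fun f g hfg hf h => ?_) hf
  -- The vanishing set is closed in `L¹`, because additivity and the bound make `D` Lipschitz there.
  · have hL : LipschitzWith C.toNNReal fun f : X →₁[m] ℂ => D f :=
      LipschitzWith.of_dist_le_mul fun f g => by
        have h : (∫⁻ x, ‖f x - g x‖ₑ ∂m).toReal = ∫ x, ‖f x - g x‖ ∂m :=
          (integral_norm_eq_lintegral_enorm
            ((L1.integrable_coeFn f).sub (L1.integrable_coeFn g)).aestronglyMeasurable).symm
        rw [dist_eq_norm, dist_eq_norm, L1.norm_sub_eq_lintegral, h]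
        refine (hsub _ _ (L1.integrable_coeFn f) (L1.integrable_coeFn g)).trans ?_
        gcongr
        exact Real.le_coe_toNNReal C
    exact isClosed_singleton.preimage hL.continuous
  -- `D` acts on functions rather than on classes; the `L¹` bound forces it to agree on a.e. equal
  -- ones.
  · have h1 := hsub f g hf (hf.congr hfg)
    rw [integral_congr_ae (g := fun _ => (0 : ℝ)) (hfg.mono fun x hx => by simp [hx])] at h1
    simpa [h] using h1

theorem norm_cintegral_le (ν : ComplexMeasure X) {m : Measure X} (hm : ν.variation ≤ m)
    {f : X → ℂ} (hf : Integrable f m) : ‖cintegral ν f‖ ≤ ∫ x, ‖f x‖ ∂m := by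
  have h1 := VectorMeasure.norm_integral_le_integral_norm (μ := ν) (f := f)
    (B := ContinuousLinearMap.mul ℝ ℂ)
  have h2 : ‖ContinuousLinearMap.mul ℝ ℂ‖ ≤ 1 := ContinuousLinearMap.opNorm_mul_le ℝ ℂ
  have h3 : ∫ x, ‖f x‖ ∂ν.variation ≤ ∫ x, ‖f x‖ ∂m :=
    integral_mono_measure hm (Filter.Eventually.of_forall fun _ => norm_nonneg _) hf.norm
  have h0 : 0 ≤ ∫ x, ‖f x‖ ∂ν.variation := integral_nonneg fun _ => norm_nonneg _
  calc _ ≤ ‖ContinuousLinearMap.mul ℝ ℂ‖ * ∫ x, ‖f x‖ ∂ν.variation := h1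
    _ ≤ 1 * ∫ x, ‖f x‖ ∂ν.variation := by gcongr
    _ ≤ _ := by rwa [one_mul]

theorem cintegral_add {ν : ComplexMeasure X} {f g : X → ℂ} (hf : ν.Integrable f)
    (hg : ν.Integrable g) : cintegral ν (f + g) = cintegral ν f + cintegral ν g :=
  VectorMeasure.integral_add hf hg

theorem cintegral_indicator_const (ν : ComplexMeasure X) (c : ℂ) {s : Set X}
    (hs : MeasurableSet s) : cintegral ν (s.indicator fun _ => c) = c * ν s :=
  VectorMeasure.integral_indicator_const c hs

/-- `cintegral` is built from a pairing bilinear over `ℝ`, so homogeneity for complex scalars needs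
its own density argument. -/
theorem cintegral_const_mul {ν : ComplexMeasure X} {f : X → ℂ} (hf : ν.Integrable f) (c : ℂ) :
    cintegral ν (fun x => c * f x) = c * cintegral ν f := by
  refine sub_eq_zero.1 (eq_zero_of_indicator_eq_zero (m := ν.variation)
    (fun f => cintegral ν (fun x => c * f x) - c * cintegral ν f) (‖c‖ + ‖c‖)
    (fun f g hf hg => ?_) (fun f hf => ?_) (fun d s hs => ?_) hf)
  · have h : (fun x => c * (f + g) x) = (fun x => c * f x) + fun x => c * g x := by
      ext x; simp [mul_add]
    simp only [h]
    rw [cintegral_add (hf.const_mul c) (hg.const_mul c), cintegral_add hf hg]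
    ring
  · have h1 := norm_cintegral_le ν le_rfl (hf.const_mul c)
    have h2 := norm_cintegral_le ν le_rfl hf
    simp only [norm_mul, integral_const_mul] at h1
    refine (norm_sub_le _ _).trans ?_
    rw [norm_mul, add_mul]
    gcongr
  · have h : (fun x => c * s.indicator (fun _ => d) x) = s.indicator fun _ => c * d := by
      ext x; by_cases hx : x ∈ s <;> simp [hx]
    simp only [h, cintegral_indicator_const _ _ hs]
    ring

theorem norm_integral_le_of_le_measure {m m' : Measure X} (h : m ≤ m') {f : X → ℂ}
    (hf : Integrable f m') : ‖∫ x, f x ∂m‖ ≤ ∫ x, ‖f x‖ ∂m' :=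
  (norm_integral_le_integral_norm f).trans
    (integral_mono_measure h (Filter.Eventually.of_forall fun _ => norm_nonneg _) hf.norm)

/-- A complex measure is a combination of four finite positive measures, and so are its
integrals. -/
theorem exists_cintegral_eq (ν : ComplexMeasure X) :
    ∃ p q r s : Measure X, IsFiniteMeasure p ∧ IsFiniteMeasure q ∧ IsFiniteMeasure r ∧
      IsFiniteMeasure s ∧
      (∀ Δ, MeasurableSet Δ →
        ν Δ = (p.real Δ - q.real Δ : ℂ) + Complex.I * (r.real Δ - s.real Δ)) ∧
      ∀ f : X → ℂ, Measurable f → ∀ C : ℝ, (∀ x, ‖f x‖ ≤ C) →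
        cintegral ν f =
          (∫ x, f x ∂p - ∫ x, f x ∂q) + Complex.I * (∫ x, f x ∂r - ∫ x, f x ∂s) := by
  set p := (ComplexMeasure.re ν).toJordanDecomposition.posPart
  set q := (ComplexMeasure.re ν).toJordanDecomposition.negPart
  set r := (ComplexMeasure.im ν).toJordanDecomposition.posPart
  set s := (ComplexMeasure.im ν).toJordanDecomposition.negPart
  have hν : ∀ Δ, MeasurableSet Δ →
      ν Δ = (p.real Δ - q.real Δ : ℂ) + Complex.I * (r.real Δ - s.real Δ) := fun Δ hΔ => by
    have h1 := (ComplexMeasure.re ν).apply_eq_posPart_real_sub_negPart_real hΔ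
    have h2 := (ComplexMeasure.im ν).apply_eq_posPart_real_sub_negPart_real hΔ
    rw [← Complex.re_add_im (ν Δ), mul_comm]
    change (((ComplexMeasure.re ν Δ : ℝ) : ℂ)) + Complex.I * ((ComplexMeasure.im ν Δ : ℝ) : ℂ) = _
    rw [h1, h2]
    push_cast
    rfl
  refine ⟨p, q, r, s, inferInstance, inferInstance, inferInstance, inferInstance, hν,
    fun f hf C hC => sub_eq_zero.1 ?_⟩
  -- One finite measure dominating all five involved, so that a single `L¹` space serves every term;
  -- the bound 5 below counts them.
  let m := ν.variation + (p + q + (r + s))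
  have hmν : ν.variation ≤ m := Measure.le_add_right le_rfl
  have hmp : p ≤ m := Measure.le_add_left (Measure.le_add_right (Measure.le_add_right le_rfl))
  have hmq : q ≤ m := Measure.le_add_left (Measure.le_add_right (Measure.le_add_left le_rfl))
  have hmr : r ≤ m := Measure.le_add_left (Measure.le_add_left (Measure.le_add_right le_rfl))
  have hms : s ≤ m := Measure.le_add_left (Measure.le_add_left (Measure.le_add_left le_rfl))
  refine eq_zero_of_indicator_eq_zero (m := m) (fun f => cintegral ν f -
    ((∫ x, f x ∂p - ∫ x, f x ∂q) + Complex.I * (∫ x, f x ∂r - ∫ x, f x ∂s))) 5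
    (fun f g hf hg => ?_) (fun f hf => ?_) (fun c Δ hΔ => ?_)
    (Integrable.of_bound hf.aestronglyMeasurable C (Filter.Eventually.of_forall hC))
  · rw [cintegral_add (hf.mono_measure hmν) (hg.mono_measure hmν),
      integral_add' (hf.mono_measure hmp) (hg.mono_measure hmp),
      integral_add' (hf.mono_measure hmq) (hg.mono_measure hmq),
      integral_add' (hf.mono_measure hmr) (hg.mono_measure hmr),
      integral_add' (hf.mono_measure hms) (hg.mono_measure hms)]
    ring
  · have h0 := norm_cintegral_le ν hmν hf
    have h1 := norm_integral_le_of_le_measure hmp hf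
    have h2 := norm_integral_le_of_le_measure hmq hf
    have h3 := norm_integral_le_of_le_measure hmr hf
    have h4 := norm_integral_le_of_le_measure hms hf
    have e1 := norm_sub_le (cintegral ν f)
      ((∫ x, f x ∂p - ∫ x, f x ∂q) + Complex.I * (∫ x, f x ∂r - ∫ x, f x ∂s))
    have e2 := norm_add_le (∫ x, f x ∂p - ∫ x, f x ∂q)
      (Complex.I * (∫ x, f x ∂r - ∫ x, f x ∂s))
    have e3 := norm_sub_le (∫ x, f x ∂p) (∫ x, f x ∂q)
    have e4 := norm_sub_le (∫ x, f x ∂r) (∫ x, f x ∂s)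
    rw [norm_mul, Complex.norm_I, one_mul] at e2
    linarith
  · rw [cintegral_indicator_const ν c hΔ, integral_indicator_const c hΔ,
      integral_indicator_const c hΔ, integral_indicator_const c hΔ, integral_indicator_const c hΔ,
      hν Δ hΔ]
    simp only [Complex.real_smul]
    ring

theorem cintegral_map (ν : ComplexMeasure X) {Y : Type*} [MeasurableSpace Y] {g : X → Y}
    (hg : Measurable g) {f : Y → ℂ} (hf : Measurable f) {C : ℝ} (hC : ∀ y, ‖f y‖ ≤ C) :
    cintegral (ν.map g) f = cintegral ν (fun x => f (g x)) :=
  VectorMeasure.integral_map hg hf.aestronglyMeasurable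
    (Integrable.of_bound (hf.comp hg).aestronglyMeasurable C
      (Filter.Eventually.of_forall fun x => hC (g x)))

theorem norm_exp_neg_I_mul (x : ℝ) : ‖Complex.exp (-(Complex.I * x))‖ = 1 := by
  rw [show -(Complex.I * x) = ((-x : ℝ) : ℂ) * Complex.I by push_cast; ring,
    Complex.norm_exp_ofReal_mul_I]

end ComplexMeasure

/-- A complex measure on a Euclidean space is determined by its Fourier transform. -/
theorem complexMeasure_ext_of_fourier {E : Type*} [NormedAddCommGroup E] [InnerProductSpace ℝ E]
    [CompleteSpace E] [SecondCountableTopology E] [MeasurableSpace E] [BorelSpace E]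
    {ν₁ ν₂ : ComplexMeasure E}
    (h : ∀ t : E, cintegral ν₁ (fun x => Complex.exp (-(Complex.I * (inner ℝ x t : ℝ)))) =
      cintegral ν₂ (fun x => Complex.exp (-(Complex.I * (inner ℝ x t : ℝ))))) : ν₁ = ν₂ := by
  obtain ⟨p, q, r, s, _, _, _, _, hν, hint⟩ := exists_cintegral_eq (ν₁ - ν₂)
  have hm : ∀ t : E, Measurable fun x : E => Complex.exp (-(Complex.I * (inner ℝ x t : ℝ))) :=
    fun t => by fun_prop
  have h1 : ∀ t : E, (charFun p t - charFun q t) + Complex.I * (charFun r t - charFun s t) = 0 := by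
    intro t
    -- `charFun` carries the opposite sign in the exponent, hence the evaluation at `-t`.
    have hI : ∀ ν : ComplexMeasure E,
        ν.Integrable fun x : E => Complex.exp (-(Complex.I * (inner ℝ x (-t) : ℝ))) := fun ν =>
      Integrable.of_bound (hm _).aestronglyMeasurable 1
        (Filter.Eventually.of_forall fun x => (norm_exp_neg_I_mul _).le)
    have h2 := hint _ (hm (-t)) 1 fun x => (norm_exp_neg_I_mul _).le
    have h3 : cintegral (ν₁ - ν₂) (fun x => Complex.exp (-(Complex.I * (inner ℝ x (-t) : ℝ)))) = 0 :=
      (VectorMeasure.integral_sub_vectorMeasure (hI ν₁) (hI ν₂)).trans (sub_eq_zero.2 (h (-t)))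
    rw [h3] at h2
    have h4 : ∀ x : E, Complex.exp (-(Complex.I * (inner ℝ x (-t) : ℝ))) =
        Complex.exp ((inner ℝ x t : ℝ) * Complex.I) := fun x => by
      rw [inner_neg_right]; push_cast; ring_nf
    simp only [h4] at h2
    exact h2.symm
  -- For a positive measure, `charFun` at `-t` is the conjugate of its value at `t`. Conjugating `h1
  -- (-t)` therefore flips only the sign of `I`, and the sum and difference with `h1 t` separate the
  -- real and imaginary parts of the measure.
  have h2 : ∀ t : E, (charFun p t - charFun q t) - Complex.I * (charFun r t - charFun s t) = 0 := by
    intro t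
    have h3 := congrArg (starRingEnd ℂ) (h1 (-t))
    simpa [charFun_neg, ← sub_eq_add_neg] using h3
  have hpq : p = q := Measure.ext_of_charFun <| funext fun t => by
    linear_combination (h1 t + h2 t) / 2
  have hrs : r = s := Measure.ext_of_charFun <| funext fun t => by
    linear_combination (-Complex.I / 2) * (h1 t - h2 t) +
      (charFun r t - charFun s t) * Complex.I_sq
  refine sub_eq_zero.1 (VectorMeasure.ext fun Δ hΔ => ?_)
  rw [hν Δ hΔ, hpq, hrs]
  simp

/-! ### Multiplicativity of the bounded functional calculus -/

namespace SpectralMeasure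

variable {X : Type*} [MeasurableSpace X] {H : Type*}
  [NormedAddCommGroup H] [InnerProductSpace ℂ H] [CompleteSpace H]

theorem pairing_apply (E : SpectralMeasure X H) (ψ φ : H) (Δ : Set X) :
    E.pairing ψ φ Δ = inner ℂ ψ (E.proj Δ φ) := rfl

theorem inner_proj_left (E : SpectralMeasure X H) {Δ : Set X} (hΔ : MeasurableSet Δ) (ψ φ : H) :
    inner ℂ (E.proj Δ ψ) φ = inner ℂ ψ (E.proj Δ φ) := by
  have h : (E.proj Δ).adjoint = E.proj Δ := (E.isStarProjection Δ hΔ).isSelfAdjoint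
  rw [← ContinuousLinearMap.adjoint_inner_left, h]

theorem proj_union (E : SpectralMeasure X H) {Δ Δ' : Set X} (hΔ : MeasurableSet Δ)
    (hΔ' : MeasurableSet Δ') (hd : Disjoint Δ Δ') (φ : H) :
    E.proj (Δ ∪ Δ') φ = E.proj Δ φ + E.proj Δ' φ := by
  refine ext_inner_left ℂ fun ψ => ?_
  rw [inner_add_right]
  exact VectorMeasure.of_union (v := E.pairing ψ φ) hd hΔ hΔ'

theorem proj_proj_self (E : SpectralMeasure X H) {Δ : Set X} (hΔ : MeasurableSet Δ) (φ : H) :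
    E.proj Δ (E.proj Δ φ) = E.proj Δ φ :=
  congrArg (fun T : H →L[ℂ] H => T φ) (E.isStarProjection Δ hΔ).isIdempotentElem

/-- With `χ = E(Δ')φ`, additivity gives `‖E(Δ ∪ Δ')χ‖² = ‖E(Δ)χ‖² + ‖χ‖²`, while a projection cannot
increase the norm of `χ`. -/
theorem proj_proj_of_disjoint (E : SpectralMeasure X H) {Δ Δ' : Set X} (hΔ : MeasurableSet Δ)
    (hΔ' : MeasurableSet Δ') (hd : Disjoint Δ Δ') (φ : H) : E.proj Δ (E.proj Δ' φ) = 0 := by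
  have h : E.proj (Δ ∪ Δ') (E.proj Δ' φ) = E.proj Δ (E.proj Δ' φ) + E.proj Δ' φ := by
    rw [E.proj_union hΔ hΔ' hd, E.proj_proj_self hΔ']
  have h1 := congrArg (inner ℂ (E.proj Δ' φ)) h
  rw [inner_add_right, E.inner_proj (hΔ.union hΔ'), E.inner_proj hΔ, inner_self_eq_norm_sq_to_K,
    inner_self_eq_norm_sq_to_K, inner_self_eq_norm_sq_to_K] at h1
  have h2 : ‖E.proj (Δ ∪ Δ') (E.proj Δ' φ)‖ ^ 2 =
      ‖E.proj Δ (E.proj Δ' φ)‖ ^ 2 + ‖E.proj Δ' φ‖ ^ 2 := by exact_mod_cast h1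
  have h3 := E.norm_proj_le (hΔ.union hΔ') (E.proj Δ' φ)
  have h4 : ‖E.proj (Δ ∪ Δ') (E.proj Δ' φ)‖ ^ 2 ≤ ‖E.proj Δ' φ‖ ^ 2 := by gcongr
  exact norm_eq_zero.1 (pow_eq_zero_iff two_ne_zero |>.1
    (le_antisymm (by linarith) (sq_nonneg ‖E.proj Δ (E.proj Δ' φ)‖)))

theorem proj_proj (E : SpectralMeasure X H) {Δ Δ' : Set X} (hΔ : MeasurableSet Δ)
    (hΔ' : MeasurableSet Δ') (φ : H) : E.proj Δ (E.proj Δ' φ) = E.proj (Δ ∩ Δ') φ := by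
  have h1 : E.proj Δ' φ = E.proj (Δ ∩ Δ') φ + E.proj (Δ' \ Δ) φ := by
    rw [← E.proj_union (hΔ.inter hΔ') (hΔ'.diff hΔ)
      (Set.disjoint_sdiff_right.mono_left Set.inter_subset_left), Set.inter_comm,
      Set.inter_union_sdiff]
  have h2 : E.proj Δ (E.proj (Δ ∩ Δ') φ) = E.proj (Δ ∩ Δ') φ := by
    have h3 : ∀ χ : H, E.proj Δ χ = E.proj (Δ ∩ Δ') χ + E.proj (Δ \ Δ') χ := fun χ => by
      rw [← E.proj_union (hΔ.inter hΔ') (hΔ.diff hΔ')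
        (Set.disjoint_sdiff_right.mono_left Set.inter_subset_right), Set.inter_union_sdiff]
    rw [h3, E.proj_proj_self (hΔ.inter hΔ'), E.proj_proj_of_disjoint (hΔ.diff hΔ')
      (hΔ.inter hΔ') (Set.disjoint_sdiff_left.mono_right Set.inter_subset_right), add_zero]
  rw [h1, _root_.map_add, h2, E.proj_proj_of_disjoint hΔ (hΔ'.diff hΔ) Set.disjoint_sdiff_right,
    add_zero]

theorem inner_boundedIntegral (E : SpectralMeasure X H) {f : X → ℂ} (hf : Measurable f)
    {C : ℝ} (hC : ∀ x, ‖f x‖ ≤ C) (ψ φ : H) :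
    inner ℂ ψ (E.boundedIntegral f φ) = cintegral (E.pairing ψ φ) f :=
  Classical.epsilon_spec (E.exists_boundedIntegral hf hC) ψ φ

theorem pairing_proj_left (E : SpectralMeasure X H) {Δ : Set X} (hΔ : MeasurableSet Δ)
    (ψ φ : H) : E.pairing (E.proj Δ ψ) φ = (E.pairing ψ φ).restrict Δ :=
  VectorMeasure.ext fun s hs => by
    rw [VectorMeasure.restrict_apply _ hΔ hs, pairing_apply, pairing_apply,
      E.inner_proj_left hΔ, E.proj_proj hΔ hs, Set.inter_comm]

/-- Moving the self-adjoint `E(Δ)` to the left argument restricts the pairing measure to `Δ`. Thus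
`⟨ψ, E(·) (∫ g dE) φ⟩` has density `g` with respect to `⟨ψ, E(·) φ⟩`. -/
theorem pairing_boundedIntegral_apply (E : SpectralMeasure X H) {g : X → ℂ} (hg : Measurable g)
    {C : ℝ} (hC : ∀ x, ‖g x‖ ≤ C) (ψ φ : H) {Δ : Set X} (hΔ : MeasurableSet Δ) :
    E.pairing ψ (E.boundedIntegral g φ) Δ = cintegral (E.pairing ψ φ) (Δ.indicator g) := by
  rw [pairing_apply, ← E.inner_proj_left hΔ, E.inner_boundedIntegral hg hC,
    E.pairing_proj_left hΔ]
  exact (VectorMeasure.integral_indicator hΔ).symm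

theorem cintegral_pairing_boundedIntegral (E : SpectralMeasure X H) {f g : X → ℂ}
    (hf : Measurable f) (hg : Measurable g) {C C' : ℝ} (hC : ∀ x, ‖f x‖ ≤ C)
    (hC' : ∀ x, ‖g x‖ ≤ C') (ψ φ : H) :
    cintegral (E.pairing ψ (E.boundedIntegral g φ)) f =
      cintegral (E.pairing ψ φ) (fun x => f x * g x) := by
  set ν := E.pairing ψ φ
  set ν' := E.pairing ψ (E.boundedIntegral g φ)
  let m := ν.variation + ν'.variation
  have hm : ν.variation ≤ m := Measure.le_add_right le_rfl
  have hm' : ν'.variation ≤ m := Measure.le_add_left le_rfl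
  have hmul : ∀ f, Integrable f m → Integrable (fun x => f x * g x) m := fun f hf =>
    hf.mul_bdd hg.aestronglyMeasurable (Filter.Eventually.of_forall hC')
  -- In the constant `1 + C'`, the first integral contributes 1 and the factor `g` in the second
  -- contributes `C'`.
  refine sub_eq_zero.1 (eq_zero_of_indicator_eq_zero (m := m)
    (fun f => cintegral ν' f - cintegral ν fun x => f x * g x) (1 + C')
    (fun f₁ f₂ h₁ h₂ => ?_) (fun f hf => ?_) (fun c Δ hΔ => ?_)
    (Integrable.of_bound hf.aestronglyMeasurable C (Filter.Eventually.of_forall hC)))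
  · have h : (fun x => (f₁ + f₂) x * g x) = (fun x => f₁ x * g x) + fun x => f₂ x * g x := by
      ext x; simp [add_mul]
    simp only [h]
    rw [cintegral_add (h₁.mono_measure hm') (h₂.mono_measure hm'),
      cintegral_add ((hmul f₁ h₁).mono_measure hm) ((hmul f₂ h₂).mono_measure hm)]
    ring
  · have h1 := norm_cintegral_le ν' hm' hf
    have h2 := norm_cintegral_le ν hm (hmul f hf)
    have h3 : ∫ x, ‖f x * g x‖ ∂m ≤ ∫ x, C' * ‖f x‖ ∂m :=
      integral_mono (hmul f hf).norm (hf.norm.const_mul C') fun x => by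
        dsimp only
        rw [norm_mul, mul_comm]
        exact mul_le_mul_of_nonneg_right (hC' x) (norm_nonneg _)
    rw [integral_const_mul] at h3
    have h4 := norm_sub_le (cintegral ν' f) (cintegral ν fun x => f x * g x)
    linarith
  · have h : (fun x => Δ.indicator (fun _ => c) x * g x) = fun x => c * Δ.indicator g x := by
      ext x; by_cases hx : x ∈ Δ <;> simp [hx]
    have hgi : ν.Integrable (Δ.indicator g) :=
      (Integrable.of_bound hg.aestronglyMeasurable C'
        (Filter.Eventually.of_forall hC')).indicator hΔ
    simp only [h]
    rw [cintegral_indicator_const _ _ hΔ, cintegral_const_mul hgi,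
      E.pairing_boundedIntegral_apply hg hC' ψ φ hΔ, sub_self]

theorem boundedIntegral_mul (E : SpectralMeasure X H) {f g : X → ℂ}
    (hf : Measurable f) (hg : Measurable g) {C C' : ℝ} (hC : ∀ x, ‖f x‖ ≤ C)
    (hC' : ∀ x, ‖g x‖ ≤ C') :
    E.boundedIntegral f * E.boundedIntegral g = E.boundedIntegral fun x => f x * g x := by
  have hfg : ∀ x, ‖f x * g x‖ ≤ C * C' := fun x => by
    rw [norm_mul]
    exact mul_le_mul (hC x) (hC' x) (norm_nonneg _) ((norm_nonneg _).trans (hC x))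
  ext φ
  refine ext_inner_left ℂ fun ψ => ?_
  rw [mul_apply_eq_comp, E.inner_boundedIntegral hf hC,
    E.inner_boundedIntegral (f := fun x => f x * g x) (hf.mul hg) hfg,
    E.cintegral_pairing_boundedIntegral hf hg hC hC']

theorem boundedIntegral_one (E : SpectralMeasure X H) : E.boundedIntegral (fun _ => 1) = 1 := by
  ext φ
  refine ext_inner_left ℂ fun ψ => ?_
  rw [E.inner_boundedIntegral (C := 1) measurable_const (by simp),
    ← Set.indicator_univ fun _ : X => (1 : ℂ),
    cintegral_indicator_const _ _ MeasurableSet.univ, pairing_apply, E.univ, one_mul]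

theorem distribution_univ (E : SpectralMeasure X H) {φ : H} (hφ : φ ≠ 0) :
    E.distribution φ Set.univ = 1 := by
  change ((‖φ‖ ^ 2 : ℝ) : ℂ)⁻¹ * inner ℂ φ (E.proj Set.univ φ) = 1
  rw [E.univ, one_apply_eq_self, inner_self_eq_norm_sq_to_K]
  have : (‖φ‖ : ℂ) ≠ 0 := by simpa using hφ
  push_cast
  exact inv_mul_cancel₀ (pow_ne_zero 2 this)

theorem distribution_map (E : SpectralMeasure X H) {Y : Type*} [MeasurableSpace Y] {g : X → Y}
    (hg : Measurable g) (φ : H) : (E.map g hg).distribution φ = (E.distribution φ).map g :=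
  VectorMeasure.ext fun Δ hΔ => by
    rw [VectorMeasure.map_apply _ hg hΔ]
    change _ * inner ℂ φ ((E.map g hg).proj Δ φ) = _ * inner ℂ φ (E.proj (g ⁻¹' Δ) φ)
    simp only [SpectralMeasure.map, if_pos hΔ]

theorem cintegral_distribution (E : SpectralMeasure X H) {f : X → ℂ} (hf : Measurable f)
    {C : ℝ} (hC : ∀ x, ‖f x‖ ≤ C) (φ : H) :
    cintegral (E.distribution φ) f =
      inner ℂ φ (E.boundedIntegral f φ) / ((‖φ‖ ^ 2 : ℝ) : ℂ) := by
  rw [distribution, cintegral_smul (Integrable.of_bound hf.aestronglyMeasurable C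
    (Filter.Eventually.of_forall hC)), E.inner_boundedIntegral hf hC, div_eq_inv_mul]

end SpectralMeasure

/-! ### Unitary groups and the two marginals -/

variable {H : Type*} [NormedAddCommGroup H] [InnerProductSpace ℂ H] [CompleteSpace H]

theorem measurable_exp_neg_I_mul (t : ℝ) :
    Measurable fun a : ℝ => Complex.exp (-(Complex.I * t * a)) := by fun_prop

theorem norm_exp_neg_I_mul_mul_le (t a : ℝ) : ‖Complex.exp (-(Complex.I * t * a))‖ ≤ 1 := by
  rw [mul_assoc, ← Complex.ofReal_mul]
  exact (norm_exp_neg_I_mul (t * a)).le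

theorem expOp_zero (A : H →ₗ.[ℂ] H) : expOp A 0 = 1 := by
  rw [expOp, ← (spectralMeasure A).boundedIntegral_one]
  simp

theorem expOp_mul_expOp (A : H →ₗ.[ℂ] H) (s t : ℝ) : expOp A s * expOp A t = expOp A (s + t) := by
  rw [expOp, expOp, SpectralMeasure.boundedIntegral_mul _ (measurable_exp_neg_I_mul s)
    (measurable_exp_neg_I_mul t) (norm_exp_neg_I_mul_mul_le s) (norm_exp_neg_I_mul_mul_le t), expOp]
  congr 1
  ext a
  rw [← Complex.exp_add]
  push_cast
  ring_nf

/-- The two outer exponents add up to `⟨s, 1⟩ = Re s`, so `α` cancels. -/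
theorem hashCnv_zero_right (A B : H →ₗ.[ℂ] H) (α s : ℂ) : hashCnv A B α s 0 = expOp A s.re := by
  rw [hashCnv, expOp_zero, mul_one, expOp_mul_expOp]
  congr 1
  simp only [dot, Complex.div_re, Complex.div_im, Complex.sub_re, Complex.sub_im, Complex.add_re,
    Complex.add_im, Complex.one_re, Complex.one_im, Complex.re_ofNat, Complex.im_ofNat,
    Complex.normSq_ofNat]
  ring

theorem hashCnv_zero_left (A B : H →ₗ.[ℂ] H) (α : ℂ) (t : ℝ) : hashCnv A B α 0 t = expOp B t := by
  have h : ∀ z, dot 0 z = 0 := fun z => by simp [dot]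
  rw [hashCnv, h, h, expOp_zero, one_mul, mul_one]

theorem cintegral_distribution_exp (A : H →ₗ.[ℂ] H) (φ : H) (t : ℝ) :
    cintegral ((spectralMeasure A).distribution φ)
        (fun a : ℝ => Complex.exp (-(Complex.I * t * a))) =
      inner ℂ φ (expOp A t φ) / ((‖φ‖ ^ 2 : ℝ) : ℂ) :=
  SpectralMeasure.cintegral_distribution _ (measurable_exp_neg_I_mul t)
    (norm_exp_neg_I_mul_mul_le t) φ

/-- The distribution is pushed forward from the real axis, where `⟨a, s⟩ = a * s.re`; hence only the
real part of `s` matters. -/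
theorem cintegral_normal_distribution_exp (A : H →ₗ.[ℂ] H) (φ : H) (s : ℂ) :
    cintegral ((normalSpectralMeasure A).distribution φ)
        (fun z : ℂ => Complex.exp (-(Complex.I * (inner ℝ z s : ℝ)))) =
      inner ℂ φ (expOp A s.re φ) / ((‖φ‖ ^ 2 : ℝ) : ℂ) := by
  rw [normalSpectralMeasure, SpectralMeasure.distribution_map,
    cintegral_map (C := 1) _ Complex.measurable_ofReal (by fun_prop)
      (fun z => (norm_exp_neg_I_mul _).le), ← cintegral_distribution_exp]
  congr 1
  ext a
  simp [Complex.inner, mul_comm, mul_left_comm]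

theorem map_fst_eq_distribution (A B : H →ₗ.[ℂ] H) (φ : H) (α : ℂ) (μ : ComplexMeasure (ℂ × ℝ))
    (hμ : ∀ s : ℂ, fourier μ s 0 =
      inner ℂ φ (hashCnv A B α s 0 φ) / ((‖φ‖ ^ 2 : ℝ) : ℂ)) :
    μ.map Prod.fst = (normalSpectralMeasure A).distribution φ := by
  refine complexMeasure_ext_of_fourier fun s => ?_
  rw [cintegral_map (C := 1) _ measurable_fst (by fun_prop)
    (fun z => (norm_exp_neg_I_mul _).le), cintegral_normal_distribution_exp,
    ← hashCnv_zero_right A B α, ← hμ s, fourier]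
  congr 1
  ext p
  simp [dot, Complex.inner, mul_comm]

theorem map_snd_eq_distribution (A B : H →ₗ.[ℂ] H) (φ : H) (α : ℂ) (μ : ComplexMeasure (ℂ × ℝ))
    (hμ : ∀ t : ℝ, fourier μ 0 t =
      inner ℂ φ (hashCnv A B α 0 t φ) / ((‖φ‖ ^ 2 : ℝ) : ℂ)) :
    μ.map Prod.snd = (spectralMeasure B).distribution φ := by
  refine complexMeasure_ext_of_fourier fun t => ?_
  have h : (fun b : ℝ => Complex.exp (-(Complex.I * (inner ℝ b t : ℝ)))) =
      fun b : ℝ => Complex.exp (-(Complex.I * t * b)) := by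
    ext b
    simp [mul_assoc]
  rw [h, cintegral_map (C := 1) _ measurable_snd (measurable_exp_neg_I_mul t)
    (norm_exp_neg_I_mul_mul_le t), cintegral_distribution_exp, ← hashCnv_zero_left A B α,
    ← hμ t, fourier]
  congr 1
  ext p
  simp [dot, mul_assoc]

end QuasiJoint

theorem mainTheorem4 {H : Type*} [NormedAddCommGroup H] [InnerProductSpace ℂ H] [CompleteSpace H]
    (A B : H →ₗ.[ℂ] H) (hA : IsSelfAdjoint A) (hB : IsSelfAdjoint B) (φ : H) (hφ : φ ≠ 0) (α : ℂ)
    (μ : MeasureTheory.ComplexMeasure (ℂ × ℝ))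
    (hμ : ∀ (s : ℂ) (t : ℝ), QuasiJoint.fourier μ s t =
      inner ℂ φ (QuasiJoint.hashCnv A B α s t φ) / ((‖φ‖ ^ 2 : ℝ) : ℂ)) :
    QuasiJoint.IsQJPDistribution A B φ μ := by
  have h1 := QuasiJoint.map_fst_eq_distribution A B φ α μ fun s => hμ s 0
  have h2 := QuasiJoint.map_snd_eq_distribution A B φ α μ fun t => hμ 0 t
  refine ⟨?_, fun Δ hΔ => ?_, fun Δ hΔ => ?_⟩
  -- The total mass is read off the second marginal, normalised because `E(ℝ) = 1` and `φ ≠ 0`.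
  · rw [← QuasiJoint.SpectralMeasure.distribution_univ (QuasiJoint.spectralMeasure B) hφ, ← h2,
      VectorMeasure.map_apply _ measurable_snd MeasurableSet.univ, Set.preimage_univ]
  · rw [← h1, VectorMeasure.map_apply _ measurable_fst hΔ, Set.prod_univ]
  · rw [← h2, VectorMeasure.map_apply _ measurable_snd hΔ, Set.univ_prod]
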